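/- **Example 3.1.** Rings are associative with identity. For a subset $X$ of a ring $S$ put $\mathrm{r.ann}_S(X)=\{s\in S \mid xs=0 \text{ for all } x\in X\}$, and call $S$ *right zip* if every subset $X\subseteq S$ with $\mathrm{r.ann}_S(X)=\{0\}$ contains a finite subset $F\subseteq X$ with $\mathrm{r.ann}_S(F)=\{0\}$. Let $\mathbb{K}$ be any field and let $R$ be the associative unital $\mathbb{K}$-algebra presented by the generators $$A=\{a_\infty,\ a_\lambda,\ a_{0,n},\ a_{1,n},\ b_{1,n},\ b_{2,n} \mid n\ge 0,\ \lambda\in\mathbb{K}\}$$ and the relations 1. $a_{0,i}b_{1,j}=a_{0,i}b_{2,j}=a_{1,i}b_{1,j}$ for all $j\ge i\ge 0$; 2. $a_{1,i}b_{2,j}=0$ for all $j\ge i\ge 0$; 3. $a_{1,i}a_\infty=0$ and $(a_{0,i}+\lambda a_{1,i})a_\lambda=0$ for all $i\ge 0$ and all $\lambda\in\mathbb{K}$; 4. $a_\infty y=a_\lambda y=b_{k,j}y=0$ for all $j\ge 0$, $\lambda\in\mathbb{K}$, $k\in\{1,2\}$ and $y\in A$. Then $R$ is right zip, but the power series ring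 $R[[x]]$ (with $x$ a central variable) is not right zip. More precisely, the set $X=\{a_{0,i}-a_{1,i}x \mid i\ge 0\}\subseteq R[[x]]$ satisfies $\mathrm{r.ann}_{R[[x]]}(X)=\{0\}$, whereas $\mathrm{r.ann}_{R[[x]]}(F)\neq\{0\}$ for every finite subset $F\subseteq X$. -/

import Mathlib

/-- The right annihilator `{r | x * r = 0 for all x ∈ X}` of a subset `X` of a ring. -/
def rightAnn {R : Type*} [Ring R] (X : Set R) : Set R :=
  {r : R | ∀ x ∈ X, x * r = 0}

/-- A ring is right zip if every subset with zero right annihilator has a finite subset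
with zero right annihilator. -/
def IsRightZip (R : Type*) [Ring R] : Prop :=
  ∀ X : Set R, rightAnn X = {0} → ∃ F : Set R, F ⊆ X ∧ F.Finite ∧ rightAnn F = {0}

/-- The generators `a_∞`, `a_μ` (`μ ∈ K`), `a_{0,n}`, `a_{1,n}`, `b_{1,n}`, `b_{2,n}`. -/
inductive CedoGen (K : Type*) : Type _
  | aInf : CedoGen K
  | aPt (μ : K) : CedoGen K
  | a0 (n : ℕ) : CedoGen K
  | a1 (n : ℕ) : CedoGen K
  | b1 (n : ℕ) : CedoGen K
  | b2 (n : ℕ) : CedoGen K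

namespace CedoGen

/-- The generators `a_∞`, `a_μ`, `b_{1,n}`, `b_{2,n}`: those whose right multiples by all
generators vanish. -/
inductive IsTerminal {K : Type*} : CedoGen K → Prop
  | aInf : IsTerminal CedoGen.aInf
  | aPt (μ : K) : IsTerminal (CedoGen.aPt μ)
  | b1 (n : ℕ) : IsTerminal (CedoGen.b1 n)
  | b2 (n : ℕ) : IsTerminal (CedoGen.b2 n)

end CedoGen

open CedoGen in
/-- The defining relations, in the free associative unital algebra on the generators. -/
inductive CedoRel (K : Type*) [Field K] :
    FreeAlgebra K (CedoGen K) → FreeAlgebra K (CedoGen K) → Prop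
  | a0_b1_b2 (i j : ℕ) (h : i ≤ j) :
      CedoRel K (FreeAlgebra.ι K (a0 i) * FreeAlgebra.ι K (b1 j))
        (FreeAlgebra.ι K (a0 i) * FreeAlgebra.ι K (b2 j))
  | a0_b2_a1_b1 (i j : ℕ) (h : i ≤ j) :
      CedoRel K (FreeAlgebra.ι K (a0 i) * FreeAlgebra.ι K (b2 j))
        (FreeAlgebra.ι K (a1 i) * FreeAlgebra.ι K (b1 j))
  | a1_b2 (i j : ℕ) (h : i ≤ j) :
      CedoRel K (FreeAlgebra.ι K (a1 i) * FreeAlgebra.ι K (b2 j)) 0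
  | a1_aInf (i : ℕ) :
      CedoRel K (FreeAlgebra.ι K (a1 i) * FreeAlgebra.ι K aInf) 0
  | a0_a1_aPt (i : ℕ) (μ : K) :
      CedoRel K ((FreeAlgebra.ι K (a0 i) + μ • FreeAlgebra.ι K (a1 i)) *
        FreeAlgebra.ι K (aPt μ)) 0
  | terminal (z x : CedoGen K) (hz : z.IsTerminal) :
      CedoRel K (FreeAlgebra.ι K z * FreeAlgebra.ι K x) 0

/-- Cedó's algebra: the associative unital `K`-algebra presented by the generators `CedoGen K`
and the relations `CedoRel K`. -/
abbrev CedoAlgebra (K : Type*) [Field K] : Type _ := RingQuot (CedoRel K)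

/-- The image of a generator in Cedó's algebra. -/
noncomputable def CedoAlgebra.gen (K : Type*) [Field K] (g : CedoGen K) : CedoAlgebra K :=
  RingQuot.mkAlgHom K (CedoRel K) (FreeAlgebra.ι K g)

/-- The set `{a_{0,i} - a_{1,i} x | i ≥ 0}` in the power series ring `R[[x]]`, where `R` is
Cedó's algebra and `x` is a central variable. -/
noncomputable def cedoWitness (K : Type*) [Field K] : Set (PowerSeries (CedoAlgebra K)) :=
  Set.range fun i : ℕ =>
    PowerSeries.C (CedoAlgebra.gen K (CedoGen.a0 i)) -
      PowerSeries.C (CedoAlgebra.gen K (CedoGen.a1 i)) * PowerSeries.X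

/-!
The algebra embeds in the trivial square-zero extension of the free algebra on the letters
`a_{0,n}`, `a_{1,n}` by a bimodule recording the terminal generators `a_∞`, `a_μ`, `b_{k,n}` and
their products with words. Let `p = ε(p) + ∑ u, u * λ_u`, with linear forms `λ_u`, be the nonzero
polynomial part of an element `x`. Comparing lengths of words, `x * r = 0` forces `r` to be a
combination `τ` of terminal generators, with `ε(p) τ = 0` and `λ_u * τ = 0` for all `u`. If `τ ≠ 0`,
a functional compatible with the relations turns `λ * τ = 0` into one and the same linear equation
between the coefficients of `a_{0,i}` and `a_{1,i}` in `λ`, for every `i`.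

A set with zero right annihilator contains an element with `ε(p) ≠ 0`, or else an `x` not killing
`a_∞`; such an `x` has a pair of coefficients of some finite slope `μ`. Some `y` in the set does
not kill `a_μ`, so it has a pair of coefficients not proportional to the first one, and `{x, y}`
has zero right annihilator.

The coefficients of a power series killed by all `a_{0,i} - a_{1,i} x` satisfy
`a_{0,i} c_{n+1} = a_{1,i} c_n`, which makes them vanish, whereas `(b_{1,n} - b_{2,n}) + b_{2,n} x`
is killed whenever `i ≤ n`.
-/

theorem rightAnn_eq_singleton_zero_iff {R : Type*} [Ring R] {X : Set R} :
    rightAnn X = {0} ↔ ∀ r, (∀ x ∈ X, x * r = 0) → r = 0 := by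
  refine ⟨fun h r hr ↦ h.subset hr, fun h ↦ Set.Subset.antisymm h ?_⟩
  rintro _ rfl x _
  exact mul_zero x

section WordAlgebra

open MonoidAlgebra FreeMonoid

variable {K L : Type*} [CommRing K]

/-- The free `K`-algebra on `L`, realised with its basis of words. -/
abbrev WordAlgebra (K L : Type*) [CommRing K] : Type _ := MonoidAlgebra K (FreeMonoid L)

namespace WordAlgebra

/-- A letter, as an element of the free algebra. -/
noncomputable def X (l : L) : WordAlgebra K L := single (of l) 1

/-- The augmentation of the free algebra, sending every letter to `0`. -/
noncomputable def augmentation : WordAlgebra K L →ₐ[K] K :=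
  MonoidAlgebra.lift K K _ (FreeMonoid.lift fun _ ↦ 0)

/-- The linear form `λ_u` in the unique expansion `p = ε(p) + ∑ u, u * λ_u` of an element of the
free algebra, as the family of its coefficients. -/
noncomputable def lastLetters (p : WordAlgebra K L) (u : FreeMonoid L) : L →₀ K :=
  p.coeff.comapDomain (u * of ·) ((mul_right_injective u).comp of_injective).injOn

@[simp]
theorem lastLetters_apply (p : WordAlgebra K L) (u : FreeMonoid L) (l : L) :
    lastLetters p u l = p.coeff (u * of l) :=
  rfl

theorem lastLetters_add (p q : WordAlgebra K L) (u : FreeMonoid L) :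
    lastLetters (p + q) u = lastLetters p u + lastLetters q u := by
  ext; simp

theorem lastLetters_smul (c : K) (p : WordAlgebra K L) (u : FreeMonoid L) :
    lastLetters (c • p) u = c • lastLetters p u := by
  ext; simp

@[elab_as_elim]
theorem induction_left {motive : WordAlgebra K L → Prop} (p : WordAlgebra K L) (one : motive 1)
    (add : ∀ p q, motive p → motive q → motive (p + q))
    (smul : ∀ (c : K) p, motive p → motive (c • p))
    (X_mul : ∀ l p, motive p → motive (X l * p)) : motive p := by
  have word (w : FreeMonoid L) : motive (single w 1) := by
    induction w using FreeMonoid.inductionOn' with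
    | one => exact one
    | of_mul l w ih => simpa [X, single_mul_single] using X_mul l _ ih
  induction p using MonoidAlgebra.induction_linear with
  | zero => simpa using smul 0 1 one
  | add p q hp hq => exact add p q hp hq
  | single w c => simpa using smul c _ (word w)

@[simp]
theorem augmentation_X (l : L) : augmentation (X l : WordAlgebra K L) = 0 := by
  simp [augmentation, X]

theorem of_mul_ne_one (l : L) (w : FreeMonoid L) : of l * w ≠ 1 :=
  List.cons_ne_nil _ _

@[simp]
theorem coeff_X_mul_one (l : L) (p : WordAlgebra K L) : (X l * p).coeff 1 = 0 :=
  coeff_single_mul_of_forall_mul_ne _ _ (of_mul_ne_one l)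

theorem coeff_X_mul_of_mul [DecidableEq L] (l k : L) (p : WordAlgebra K L) (w : FreeMonoid L) :
    (X l * p).coeff (of k * w) = if l = k then p.coeff w else 0 := by
  split_ifs with h
  · rw [← h, X, coeff_single_mul_mul, one_mul]
  · exact coeff_single_mul_of_forall_mul_ne _ _ fun d hd ↦ h (List.cons_eq_cons.1 hd).1

theorem coeff_one_eq_augmentation (p : WordAlgebra K L) : p.coeff 1 = augmentation p := by
  induction p using induction_left with
  | one => simp
  | add p q hp hq => simp [hp, hq]
  | smul c p hp => simp [hp]
  | X_mul l p _ => simp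

@[simp]
theorem lastLetters_X_mul_one (l : L) (p : WordAlgebra K L) :
    lastLetters (X l * p) 1 = Finsupp.single l (augmentation p) := by
  classical
  ext k
  have := coeff_X_mul_of_mul l k p 1
  rw [mul_one] at this
  rw [lastLetters_apply, one_mul, this, Finsupp.single_apply, coeff_one_eq_augmentation]

theorem lastLetters_X_mul_of_mul [DecidableEq L] (l k : L) (p : WordAlgebra K L)
    (w : FreeMonoid L) :
    lastLetters (X l * p) (of k * w) = if l = k then lastLetters p w else 0 := by
  ext i
  rw [lastLetters_apply, mul_assoc, coeff_X_mul_of_mul]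
  split_ifs <;> rfl

theorem exists_coeff_ne_zero_forall_length_le {p : WordAlgebra K L} (hp : p ≠ 0) :
    ∃ w, p.coeff w ≠ 0 ∧ ∀ w', p.coeff w' ≠ 0 → w'.length ≤ w.length := by
  obtain ⟨w, hw, h⟩ := p.coeff.support.exists_max_image FreeMonoid.length
    (Finsupp.support_nonempty_iff.2 (by simpa using hp))
  exact ⟨w, by simpa using hw, fun w' hw' ↦ h w' (by simpa using hw')⟩

theorem exists_coeff_mul_ne_zero_forall_length_le [NoZeroDivisors K] {p q : WordAlgebra K L}
    (hp : p ≠ 0) (hq : q ≠ 0) :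
    ∃ u, (p * q).coeff u ≠ 0 ∧ ∀ w, p.coeff w ≠ 0 → w.length ≤ u.length := by
  obtain ⟨a, ha, ha_max⟩ := exists_coeff_ne_zero_forall_length_le hp
  obtain ⟨b, hb, hb_max⟩ := exists_coeff_ne_zero_forall_length_le hq
  have unique : UniqueMul p.coeff.support q.coeff.support a b := by
    intro c d hc hd h
    have hc := ha_max c (by simpa using hc)
    have hd := hb_max d (by simpa using hd)
    have h_length := congrArg FreeMonoid.length h
    simp only [FreeMonoid.length_mul] at h_length
    exact List.append_inj h (by change c.length = a.length; lia)
  refine ⟨a * b, ?_, fun w hw ↦ (ha_max w hw).trans (by simp)⟩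
  rw [coeff_mul_mul_of_uniqueMul unique]
  exact mul_ne_zero ha hb

end WordAlgebra

end WordAlgebra

section WordModule

open MonoidAlgebra FreeMonoid WordAlgebra

variable {K L T V : Type*} [CommRing K] [AddCommGroup T] [Module K T] [AddCommGroup V] [Module K V]

/-- The bimodule `T ⊕ K⟨L⟩ ⊗ V` over the free algebra `K⟨L⟩`, in which the product of `l : L` and
`t : T` is `B l t : V`, while letters act by `0` from the right. The second summand is stored as a
family of elements of `V` indexed by words. -/
def WordModule (_B : L → T →ₗ[K] V) : Type _ := T × (FreeMonoid L →₀ V)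

namespace WordModule

variable (B : L → T →ₗ[K] V)

noncomputable instance : AddCommGroup (WordModule B) :=
  inferInstanceAs (AddCommGroup (T × (FreeMonoid L →₀ V)))

noncomputable instance : Module K (WordModule B) :=
  inferInstanceAs (Module K (T × (FreeMonoid L →₀ V)))

/-- The element `t` of the summand `T`. -/
noncomputable def base : T →ₗ[K] WordModule B := LinearMap.inl K T (FreeMonoid L →₀ V)

/-- The component in `T`. -/
noncomputable def baseComponent : WordModule B →ₗ[K] T := LinearMap.fst K T (FreeMonoid L →₀ V)

/-- The component in `K⟨L⟩ ⊗ V`. -/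
noncomputable def wordComponent : WordModule B →ₗ[K] FreeMonoid L →₀ V :=
  LinearMap.snd K T (FreeMonoid L →₀ V)

/-- The element `1 ⊗ v` of the summand `K⟨L⟩ ⊗ V`. -/
noncomputable def oneTensor : V →ₗ[K] WordModule B :=
  LinearMap.inr K T (FreeMonoid L →₀ V) ∘ₗ Finsupp.lsingle 1

/-- Left multiplication by a letter. -/
noncomputable def letterEnd (l : L) : Module.End K (WordModule B) :=
  LinearMap.prod 0 (Finsupp.lmapDomain V K (of l * ·) ∘ₗ wordComponent B +
    Finsupp.lsingle 1 ∘ₗ B l ∘ₗ baseComponent B)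

noncomputable instance : Module (WordAlgebra K L) (WordModule B) :=
  Module.compHom _ (MonoidAlgebra.lift K _ _ (FreeMonoid.lift (letterEnd B))).toRingHom

noncomputable instance : Module (WordAlgebra K L)ᵐᵒᵖ (WordModule B) :=
  Module.compHom _ ((augmentation (K := K) (L := L)).toRingHom.fromOpposite fun _ _ ↦ .all _ _)

variable {B}

@[ext]
theorem ext {m n : WordModule B} (base : baseComponent B m = baseComponent B n)
    (word : ∀ u, wordComponent B m u = wordComponent B n u) : m = n :=
  Prod.ext base (Finsupp.ext word)

theorem smul_eq (p : WordAlgebra K L) (m : WordModule B) :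
    p • m = MonoidAlgebra.lift K _ _ (FreeMonoid.lift (letterEnd B)) p m :=
  rfl

theorem X_smul (l : L) (m : WordModule B) : (X l : WordAlgebra K L) • m = letterEnd B l m := by
  rw [smul_eq, X, lift_single, one_smul, lift_eval_of]

theorem op_smul_eq (p : WordAlgebra K L) (m : WordModule B) :
    MulOpposite.op p • m = augmentation p • m :=
  rfl

instance : IsScalarTower K (WordAlgebra K L) (WordModule B) where
  smul_assoc c p m := by simp [smul_eq]

instance : IsScalarTower K (WordAlgebra K L)ᵐᵒᵖ (WordModule B) where
  smul_assoc c p m := by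
    change augmentation (c • p.unop) • m = c • augmentation p.unop • m
    simp [mul_smul]

instance : SMulCommClass (WordAlgebra K L) (WordAlgebra K L)ᵐᵒᵖ (WordModule B) where
  smul_comm p q m := map_smul (MonoidAlgebra.lift K _ _ (FreeMonoid.lift (letterEnd B)) p)
    (augmentation q.unop) m

@[simp] theorem baseComponent_base (t : T) : baseComponent B (base B t) = t := rfl

@[simp] theorem wordComponent_base (t : T) : wordComponent B (base B t) = 0 := rfl

@[simp] theorem baseComponent_oneTensor (v : V) : baseComponent B (oneTensor B v) = 0 := rfl

@[simp]
theorem wordComponent_oneTensor (v : V) :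
    wordComponent B (oneTensor B v) = Finsupp.single 1 v :=
  rfl

@[simp]
theorem baseComponent_X_smul (l : L) (m : WordModule B) :
    baseComponent B ((X l : WordAlgebra K L) • m) = 0 := by
  rw [X_smul]; rfl

theorem wordComponent_X_smul (l : L) (m : WordModule B) :
    wordComponent B ((X l : WordAlgebra K L) • m) =
      (wordComponent B m).mapDomain (of l * ·) +
        Finsupp.single 1 (B l (baseComponent B m)) := by
  rw [X_smul]; rfl

@[simp]
theorem wordComponent_X_smul_one (l : L) (m : WordModule B) :
    wordComponent B ((X l : WordAlgebra K L) • m) 1 = B l (baseComponent B m) := by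
  rw [wordComponent_X_smul, Finsupp.add_apply, Finsupp.single_eq_same,
    Finsupp.mapDomain_of_notMem_range _ _ fun ⟨w, hw⟩ ↦ of_mul_ne_one l w hw, zero_add]

theorem wordComponent_X_smul_of_mul [DecidableEq L] (l k : L) (m : WordModule B)
    (w : FreeMonoid L) :
    wordComponent B ((X l : WordAlgebra K L) • m) (of k * w) =
      if l = k then wordComponent B m w else 0 := by
  rw [wordComponent_X_smul, Finsupp.add_apply, Finsupp.single_eq_of_ne (of_mul_ne_one k w),
    add_zero]
  split_ifs with h
  · rw [h, Finsupp.mapDomain_apply (mul_right_injective (of k))]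
  · exact Finsupp.mapDomain_of_notMem_range _ _ fun ⟨v, hv⟩ ↦ h (List.cons_eq_cons.1 hv).1

theorem X_smul_base (l : L) (t : T) :
    (X l : WordAlgebra K L) • base B t = oneTensor B (B l t) := by
  ext u
  · simp
  · simp [wordComponent_X_smul]

@[simp]
theorem baseComponent_smul (p : WordAlgebra K L) (m : WordModule B) :
    baseComponent B (p • m) = augmentation p • baseComponent B m := by
  induction p using induction_left with
  | one => simp
  | add p q hp hq => simp [add_smul, hp, hq]
  | smul c p hp => simp [smul_assoc, hp, mul_smul]
  | X_mul l p _ => simp [mul_smul]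

/-- The element of `K⟨L⟩` obtained by applying a linear form to the second factor of
`K⟨L⟩ ⊗ V`. -/
noncomputable def slice (f : V →ₗ[K] K) : (FreeMonoid L →₀ V) →ₗ[K] WordAlgebra K L :=
  (coeffLinearEquiv K).symm.toLinearMap ∘ₗ Finsupp.mapRange.linearMap f

@[simp]
theorem coeff_slice (f : V →ₗ[K] K) (σ : FreeMonoid L →₀ V) (u : FreeMonoid L) :
    (slice f σ).coeff u = f (σ u) :=
  rfl

theorem apply_wordComponent_smul (f : V →ₗ[K] K) (p : WordAlgebra K L) (m : WordModule B)
    (u : FreeMonoid L) :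
    f (wordComponent B (p • m) u) = (p * slice f (wordComponent B m)).coeff u +
      Finsupp.linearCombination K (fun l ↦ f (B l (baseComponent B m))) (lastLetters p u) := by
  classical
  induction p using induction_left generalizing u with
  | one =>
    have : lastLetters (1 : WordAlgebra K L) u = 0 := by
      ext l
      simp [one_def]
    simp [this]
  | add p q hp hq =>
    simp only [add_smul, map_add, Finsupp.add_apply, hp, hq, add_mul, coeff_add,
      lastLetters_add]
    abel
  | smul c p hp =>
    simp only [smul_assoc, map_smul, Finsupp.smul_apply, hp, smul_mul_assoc, coeff_smul,
      lastLetters_smul, smul_add]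
  | X_mul l p ih =>
    rw [mul_smul, mul_assoc]
    induction u using FreeMonoid.casesOn with
    | one => simp
    | of_mul k w =>
      rw [wordComponent_X_smul_of_mul, coeff_X_mul_of_mul, lastLetters_X_mul_of_mul]
      split_ifs <;> simp [ih]

end WordModule

end WordModule

section FieldWordModule

open MonoidAlgebra FreeMonoid WordAlgebra

variable {K L T V : Type*} [Field K] [AddCommGroup T] [Module K T] [AddCommGroup V] [Module K V]
  {B : L → T →ₗ[K] V}

namespace WordModule

theorem wordComponent_smul_base (p : WordAlgebra K L) (t : T) (u : FreeMonoid L) :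
    wordComponent B (p • base B t) u =
      Finsupp.linearCombination K (fun l ↦ B l t) (lastLetters p u) := by
  rw [← sub_eq_zero, ← Module.forall_dual_apply_eq_zero_iff K]
  intro f
  have := apply_wordComponent_smul f p (base B t) u
  simp_all [Finsupp.linearCombination_apply, Finsupp.sum]

theorem wordComponent_eq_zero_of_smul_eq_zero {p : WordAlgebra K L} (hp : p ≠ 0)
    {m : WordModule B} (h : p • m = 0) : wordComponent B m = 0 := by
  by_contra hm
  obtain ⟨v, hv⟩ := Finsupp.ne_iff.1 hm
  obtain ⟨f, hf⟩ := Module.Projective.exists_dual_ne_zero K hv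
  have hs : slice f (wordComponent B m) ≠ 0 := fun hs ↦ hf (by simpa using congr(coeff $hs v))
  obtain ⟨u, hu, hu_max⟩ := exists_coeff_mul_ne_zero_forall_length_le hp hs
  have hlast : lastLetters p u = 0 := by
    ext l
    by_contra hl
    simpa using hu_max _ hl
  have := apply_wordComponent_smul f p m u
  simp [h, hlast, hu.symm] at this

end WordModule

end FieldWordModule

namespace CedoAlgebra

open FreeMonoid WordAlgebra WordModule TrivSqZeroExt

variable {K V : Type*} [Field K] [AddCommGroup V] [Module K V]

/-- The generators `a_∞`, `a_μ`, `b_{1,n}`, `b_{2,n}`, as a type. -/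
abbrev Terminal (K : Type*) : Type _ := {g : CedoGen K // g.IsTerminal}

namespace Terminal

/-- The generator `a_∞`. -/
abbrev aInf : Terminal K := ⟨.aInf, .aInf⟩

/-- The generator `a_μ`. -/
abbrev aPt (μ : K) : Terminal K := ⟨.aPt μ, .aPt μ⟩

/-- The generator `b_{1,n}`. -/
abbrev b1 (n : ℕ) : Terminal K := ⟨.b1 n, .b1 n⟩

/-- The generator `b_{2,n}`. -/
abbrev b2 (n : ℕ) : Terminal K := ⟨.b2 n, .b2 n⟩

end Terminal

open Terminal

/-- The generator `a_{k,n}`, indexed by the pair `(k, n)`. -/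
noncomputable def letter : Fin 2 × ℕ → CedoAlgebra K
  | (0, n) => gen K (.a0 n)
  | (1, n) => gen K (.a1 n)

/-- The linear combinations of terminal generators. -/
noncomputable def term : (Terminal K →₀ K) →ₗ[K] CedoAlgebra K :=
  Finsupp.linearCombination K fun t ↦ gen K t.1

@[simp]
theorem term_single (t : Terminal K) (c : K) : term (Finsupp.single t c) = c • gen K t.1 :=
  Finsupp.linearCombination_single K c t

theorem gen_terminal_mul_gen (t : Terminal K) (g : CedoGen K) : gen K t.1 * gen K g = 0 := by
  simpa [gen] using RingQuot.mkAlgHom_rel K (CedoRel.terminal t.1 g t.2)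

@[elab_as_elim]
theorem induction_left {motive : CedoAlgebra K → Prop} (r : CedoAlgebra K) (one : motive 1)
    (add : ∀ r s, motive r → motive s → motive (r + s))
    (smul : ∀ (c : K) r, motive r → motive (c • r))
    (letter_mul : ∀ l r, motive r → motive (letter l * r))
    (terminal_mul : ∀ (t : Terminal K) r, motive r → motive (gen K t.1 * r)) : motive r := by
  have mul (p : FreeAlgebra K (CedoGen K)) :
      ∀ r, motive r → motive (RingQuot.mkAlgHom K (CedoRel K) p * r) := by
    induction p with
    | grade0 c => simpa [← Algebra.smul_def] using smul c
    | grade1 g =>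
      cases g with
      | a0 n => exact letter_mul (0, n)
      | a1 n => exact letter_mul (1, n)
      | aInf => exact terminal_mul aInf
      | aPt μ => exact terminal_mul (aPt μ)
      | b1 n => exact terminal_mul (b1 n)
      | b2 n => exact terminal_mul (b2 n)
    | mul p q hp hq => intro r hr; simpa [mul_assoc] using hp _ (hq r hr)
    | add p q hp hq => intro r hr; simpa [add_mul] using add _ _ (hp r hr) (hq r hr)
  obtain ⟨p, rfl⟩ := RingQuot.mkAlgHom_surjective K (CedoRel K) r
  simpa using mul p 1 one

/-- The relations imposed by `CedoRel` on the products of `a_{0,i}` and `a_{1,i}` with the terminal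
generators, for linear maps `B₀` and `B₁` playing the role of these products. -/
structure RespectsRelations (i : ℕ) (B₀ B₁ : (Terminal K →₀ K) →ₗ[K] V) : Prop where
  a0_b1_b2 : ∀ j, i ≤ j → B₀ (Finsupp.single (b1 j) 1) = B₀ (Finsupp.single (b2 j) 1)
  a0_b2_a1_b1 : ∀ j, i ≤ j → B₀ (Finsupp.single (b2 j) 1) = B₁ (Finsupp.single (b1 j) 1)
  a1_b2 : ∀ j, i ≤ j → B₁ (Finsupp.single (b2 j) 1) = 0
  a1_aInf : B₁ (Finsupp.single aInf 1) = 0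
  a0_a1_aPt : ∀ μ, B₀ (Finsupp.single (aPt μ) 1) + μ • B₁ (Finsupp.single (aPt μ) 1) = 0

section toExt

variable (B : Fin 2 × ℕ → (Terminal K →₀ K) →ₗ[K] V)

/-- The image of a generator under `toExt`. -/
noncomputable def genExt : CedoGen K → TrivSqZeroExt (WordAlgebra K (Fin 2 × ℕ)) (WordModule B)
  | .a0 n => inl (X (0, n))
  | .a1 n => inl (X (1, n))
  | .aInf => inr (base B (Finsupp.single aInf 1))
  | .aPt μ => inr (base B (Finsupp.single (aPt μ) 1))
  | .b1 n => inr (base B (Finsupp.single (b1 n) 1))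
  | .b2 n => inr (base B (Finsupp.single (b2 n) 1))

theorem genExt_terminal (t : Terminal K) :
    genExt B t.1 = inr (base B (Finsupp.single t 1)) := by
  obtain ⟨_, _ | _ | _ | _⟩ := t <;> rfl

theorem lift_genExt_eq_of_cedoRel (hB : ∀ i, RespectsRelations i (B (0, i)) (B (1, i)))
    ⦃p q : FreeAlgebra K (CedoGen K)⦄ (h : CedoRel K p q) :
    FreeAlgebra.lift K (genExt B) p = FreeAlgebra.lift K (genExt B) q := by
  cases h with
  | a0_b1_b2 i j h => simp [genExt, inl_mul_inr, X_smul_base, (hB i).a0_b1_b2 j h]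
  | a0_b2_a1_b1 i j h => simp [genExt, inl_mul_inr, X_smul_base, (hB i).a0_b2_a1_b1 j h]
  | a1_b2 i j h => simp [genExt, inl_mul_inr, X_smul_base, (hB i).a1_b2 j h]
  | a1_aInf i => simp [genExt, inl_mul_inr, X_smul_base, (hB i).a1_aInf]
  | a0_a1_aPt i μ =>
    have := congr(inr (R := WordAlgebra K (Fin 2 × ℕ)) (oneTensor B $((hB i).a0_a1_aPt μ)))
    simpa [genExt, inl_mul_inr, X_smul_base, add_mul] using this
  | terminal t g ht =>
    rw [map_mul, map_zero, FreeAlgebra.lift_ι_apply, FreeAlgebra.lift_ι_apply,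
      genExt_terminal B ⟨t, ht⟩]
    cases g <;> simp [genExt, inr_mul_inl, op_smul_eq]

/-- The representation of Cedó's algebra in a trivial extension of a free algebra determined by a
family of values for the products of letters with terminal generators. -/
noncomputable def toExt (hB : ∀ i, RespectsRelations i (B (0, i)) (B (1, i))) :
    CedoAlgebra K →ₐ[K] TrivSqZeroExt (WordAlgebra K (Fin 2 × ℕ)) (WordModule B) :=
  RingQuot.liftAlgHom K ⟨FreeAlgebra.lift K (genExt B), lift_genExt_eq_of_cedoRel B hB⟩

variable {B}

theorem toExt_gen (hB : ∀ i, RespectsRelations i (B (0, i)) (B (1, i))) (g : CedoGen K) :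
    toExt B hB (gen K g) = genExt B g := by
  simp [toExt, gen]

theorem toExt_letter (hB : ∀ i, RespectsRelations i (B (0, i)) (B (1, i))) (l : Fin 2 × ℕ) :
    toExt B hB (letter l) = inl (X l) := by
  obtain ⟨k, n⟩ := l
  fin_cases k <;> exact toExt_gen hB _

theorem toExt_term (hB : ∀ i, RespectsRelations i (B (0, i)) (B (1, i)))
    (τ : Terminal K →₀ K) : toExt B hB (term τ) = inr (base B τ) := by
  induction τ using Finsupp.induction_linear with
  | zero => simp
  | add σ τ hσ hτ => simp [hσ, hτ]
  | single t c =>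
    rw [term_single, map_smul, toExt_gen, genExt_terminal, ← inr_smul, ← map_smul,
      Finsupp.smul_single, smul_eq_mul, mul_one]

end toExt

/-- Left multiplication of terminal combinations by a letter. -/
noncomputable def letterMul (l : Fin 2 × ℕ) : (Terminal K →₀ K) →ₗ[K] CedoAlgebra K :=
  LinearMap.mulLeft K (letter l) ∘ₗ term

@[simp]
theorem letterMul_apply (l : Fin 2 × ℕ) (τ : Terminal K →₀ K) :
    letterMul l τ = letter l * term τ :=
  rfl

theorem respectsRelations_letterMul (i : ℕ) :
    RespectsRelations i (letterMul (K := K) (0, i)) (letterMul (1, i)) where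
  a0_b1_b2 j h := by
    simpa only [letterMul_apply, term_single, one_smul, letter, gen, map_mul, map_zero] using
      RingQuot.mkAlgHom_rel K (CedoRel.a0_b1_b2 i j h)
  a0_b2_a1_b1 j h := by
    simpa only [letterMul_apply, term_single, one_smul, letter, gen, map_mul, map_zero] using
      RingQuot.mkAlgHom_rel K (CedoRel.a0_b2_a1_b1 i j h)
  a1_b2 j h := by
    simpa only [letterMul_apply, term_single, one_smul, letter, gen, map_mul, map_zero] using
      RingQuot.mkAlgHom_rel K (CedoRel.a1_b2 i j h)
  a1_aInf := by
    simpa only [letterMul_apply, term_single, one_smul, letter, gen, map_mul, map_zero] using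
      RingQuot.mkAlgHom_rel K (CedoRel.a1_aInf i)
  a0_a1_aPt μ := by
    simpa only [letterMul_apply, term_single, one_smul, letter, gen, add_mul, smul_mul_assoc,
      map_add, map_smul, map_mul, map_zero] using
      RingQuot.mkAlgHom_rel K (CedoRel.a0_a1_aPt i μ)

/-- The representation in which the product of a letter and a terminal generator is recorded as
the element of `CedoAlgebra K` that it is. It is faithful; see `model_injective`. -/
noncomputable def model : CedoAlgebra K →ₐ[K]
    TrivSqZeroExt (WordAlgebra K (Fin 2 × ℕ)) (WordModule (letterMul (K := K))) :=
  toExt letterMul respectsRelations_letterMul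

theorem model_letter (l : Fin 2 × ℕ) : model (K := K) (letter l) = inl (X l) :=
  toExt_letter _ l

theorem model_term (τ : Terminal K →₀ K) : model (term τ) = inr (base letterMul τ) :=
  toExt_term _ τ

/-- The polynomial part of an element, obtained by dropping all terminal generators. -/
noncomputable def poly : CedoAlgebra K →ₐ[K] WordAlgebra K (Fin 2 × ℕ) :=
  (fstHom K _ _).comp model

theorem model_gen_terminal (t : Terminal K) :
    model (gen K t.1) = inr (base letterMul (Finsupp.single t 1)) :=
  (toExt_gen _ _).trans (genExt_terminal _ t)

@[simp]
theorem poly_letter (l : Fin 2 × ℕ) : poly (K := K) (letter l) = X l := by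
  simp [poly, model_letter]

@[simp]
theorem poly_gen_terminal (t : Terminal K) : poly (gen K t.1) = 0 := by
  simp [poly, model_gen_terminal]

@[simp]
theorem fst_model (r : CedoAlgebra K) : (model r).fst = poly r :=
  rfl

theorem gen_terminal_mul_letter (t : Terminal K) (l : Fin 2 × ℕ) :
    gen K t.1 * letter l = 0 := by
  obtain ⟨k, n⟩ := l
  fin_cases k <;> exact gen_terminal_mul_gen t _

theorem gen_terminal_mul (t : Terminal K) (r : CedoAlgebra K) :
    gen K t.1 * r = augmentation (poly r) • gen K t.1 := by
  induction r using induction_left with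
  | one => simp
  | add r s hr hs => simp [mul_add, add_smul, hr, hs]
  | smul c r hr => simp [hr, mul_smul]
  | letter_mul l r _ => simp [← mul_assoc, gen_terminal_mul_letter]
  | terminal_mul t' r _ => simp [← mul_assoc, gen_terminal_mul_gen]

/-- The product map from `K⟨L⟩ ⊗ CedoAlgebra K` to `CedoAlgebra K`, where `L` is the set of letters
and the first factor is written in its basis of words. -/
noncomputable def wordMul : (FreeMonoid (Fin 2 × ℕ) →₀ CedoAlgebra K) →ₗ[K] CedoAlgebra K :=
  Finsupp.lsum K fun w ↦ LinearMap.mulLeft K (FreeMonoid.lift letter w)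

theorem wordMul_single (w : FreeMonoid (Fin 2 × ℕ)) (r : CedoAlgebra K) :
    wordMul (Finsupp.single w r) = FreeMonoid.lift letter w * r := by
  simp [wordMul]

theorem wordMul_mapDomain (l : Fin 2 × ℕ) (σ : FreeMonoid (Fin 2 × ℕ) →₀ CedoAlgebra K) :
    wordMul (σ.mapDomain (of l * ·)) = letter l * wordMul σ := by
  induction σ using Finsupp.induction_linear with
  | zero => simp
  | add σ τ hσ hτ => rw [Finsupp.mapDomain_add, map_add, map_add, hσ, hτ, mul_add]
  | single w r =>
    rw [Finsupp.mapDomain_single, wordMul_single, wordMul_single, map_mul, lift_eval_of, mul_assoc]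

/-- The element of Cedó's algebra represented by an element of the bimodule underlying `model`. -/
noncomputable def ofWordModule : WordModule (letterMul (K := K)) →ₗ[K] CedoAlgebra K :=
  term ∘ₗ baseComponent letterMul + wordMul ∘ₗ wordComponent letterMul

theorem ofWordModule_apply (m : WordModule (letterMul (K := K))) :
    ofWordModule m = term (baseComponent letterMul m) + wordMul (wordComponent letterMul m) :=
  rfl

theorem ofWordModule_X_smul (l : Fin 2 × ℕ) (m : WordModule (letterMul (K := K))) :
    ofWordModule ((X l : WordAlgebra K _) • m) = letter l * ofWordModule m := by
  rw [ofWordModule_apply, ofWordModule_apply, baseComponent_X_smul, map_zero, zero_add,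
    wordComponent_X_smul, map_add, wordMul_mapDomain, wordMul_single, map_one, one_mul,
    letterMul_apply, mul_add, add_comm]

theorem eq_lift_poly_add_ofWordModule (r : CedoAlgebra K) :
    r = MonoidAlgebra.lift K _ _ (FreeMonoid.lift letter) (poly r) +
      ofWordModule (model r).snd := by
  induction r using induction_left with
  | one => simp
  | add r s hr hs =>
    nth_rw 1 [hr, hs]
    simp only [map_add, snd_add]
    abel
  | smul c r hr =>
    nth_rw 1 [hr]
    simp
  | letter_mul l r hr =>
    nth_rw 1 [hr]
    have lift_X : MonoidAlgebra.lift K _ _ (FreeMonoid.lift letter) (X l) = letter (K := K) l := by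
      simp [X]
    simp [model_letter, mul_add, ofWordModule_X_smul, lift_X]
  | terminal_mul t r _ =>
    rw [gen_terminal_mul]
    simp [model_gen_terminal, ofWordModule_apply]

theorem model_injective : Function.Injective (model (K := K)) := by
  refine (injective_iff_map_eq_zero _).2 fun r hr ↦ ?_
  rw [eq_lift_poly_add_ofWordModule r, ← fst_model, hr]
  simp

theorem exists_eq_term {r : CedoAlgebra K} (h_poly : poly r = 0)
    (h_word : wordComponent letterMul (model r).snd = 0) :
    ∃ τ, r = term τ := by
  refine ⟨baseComponent letterMul (model r).snd, ?_⟩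
  nth_rw 1 [eq_lift_poly_add_ofWordModule r]
  simp [h_poly, h_word, ofWordModule_apply]

theorem term_injective : Function.Injective (term (K := K)) := by
  intro σ τ h
  have := congr((model $h).snd)
  rw [model_term, model_term] at this
  simpa using congr(baseComponent letterMul $this)

theorem exists_eq_term_of_mul_eq_zero {x r : CedoAlgebra K} (hx : poly x ≠ 0) (h : x * r = 0) :
    ∃ τ, r = term τ := by
  have hr : poly r = 0 := by simpa [hx] using congr(poly $h)
  refine exists_eq_term hr (wordComponent_eq_zero_of_smul_eq_zero hx ?_)
  simpa [hr] using congr((model $h).snd)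

/-- A linear combination of the generators `a_{0,n}` and `a_{1,n}`. -/
noncomputable def linearForm : (Fin 2 × ℕ →₀ K) →ₗ[K] CedoAlgebra K :=
  Finsupp.linearCombination K letter

theorem mul_term_eq_zero_iff {x : CedoAlgebra K} {τ : Terminal K →₀ K} :
    x * term τ = 0 ↔
      augmentation (poly x) • τ = 0 ∧ ∀ u, linearForm (lastLetters (poly x) u) * term τ = 0 := by
  have h_form (a : Fin 2 × ℕ →₀ K) : linearForm a * term τ =
      Finsupp.linearCombination K (fun l ↦ letterMul l τ) a := by
    simp [linearForm, Finsupp.linearCombination_apply, Finsupp.sum_mul]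
  simp_rw [h_form]
  rw [← map_eq_zero_iff model model_injective, map_mul, model_term, TrivSqZeroExt.ext_iff,
    WordModule.ext_iff]
  simp [wordComponent_smul_base]

theorem linearForm_eq_sum (a : Fin 2 × ℕ →₀ K) :
    linearForm a = ∑ i ∈ a.support.image Prod.snd,
      (a (0, i) • letter (0, i) + a (1, i) • letter (1, i)) := by
  have h_supp : a.support ⊆ Finset.univ ×ˢ a.support.image Prod.snd := fun l hl ↦
    Finset.mem_product.2 ⟨Finset.mem_univ _, Finset.mem_image_of_mem _ hl⟩
  rw [linearForm, Finsupp.linearCombination_apply,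
    Finsupp.sum_of_support_subset _ h_supp _ (by simp), Finset.sum_product_right]
  simp only [Fin.sum_univ_two]

theorem linearForm_mul_aInf {a : Fin 2 × ℕ →₀ K} (ha : ∀ i, a (0, i) = 0) :
    linearForm a * term (Finsupp.single aInf 1) = 0 := by
  have h (i : ℕ) := (respectsRelations_letterMul (K := K) i).a1_aInf
  simp only [letterMul_apply] at h
  simp [linearForm_eq_sum, Finset.sum_mul, ha, h, -term_single]

theorem linearForm_mul_aPt {a : Fin 2 × ℕ →₀ K} {μ : K} (ha : ∀ i, a (1, i) = μ * a (0, i)) :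
    linearForm a * term (Finsupp.single (aPt μ) 1) = 0 := by
  have h (i : ℕ) := (respectsRelations_letterMul (K := K) i).a0_a1_aPt μ
  simp only [letterMul_apply] at h
  rw [linearForm_eq_sum, Finset.sum_mul]
  refine Finset.sum_eq_zero fun i _ ↦ ?_
  rw [ha, mul_comm, mul_smul, ← smul_add, smul_mul_assoc, add_mul, smul_mul_assoc, h, smul_zero]

theorem RespectsRelations.exists_functional {i : ℕ} {α β : (Terminal K →₀ K) →ₗ[K] V}
    (h : RespectsRelations i α β) :
    ∃ φ : CedoAlgebra K →ₗ[K] V, ∀ l τ,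
      φ (letter l * term τ) = if l.2 = i then ![α τ, β τ] l.1 else 0 := by
  let B (l : Fin 2 × ℕ) : (Terminal K →₀ K) →ₗ[K] V := if l.2 = i then ![α, β] l.1 else 0
  have hB (j : ℕ) : RespectsRelations j (B (0, j)) (B (1, j)) := by
    by_cases hj : j = i
    · simpa [B, hj] using h
    · constructor <;> simp [B, hj]
  have B_apply (l : Fin 2 × ℕ) (τ : Terminal K →₀ K) :
      B l τ = if l.2 = i then ![α τ, β τ] l.1 else 0 := by
    obtain ⟨k, j⟩ := l
    by_cases hj : j = i <;> fin_cases k <;> simp [B, hj]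
  let sndLinear : TrivSqZeroExt (WordAlgebra K (Fin 2 × ℕ)) (WordModule B) →ₗ[K] WordModule B :=
    (sndHom _ _).restrictScalars K
  refine ⟨Finsupp.lapply 1 ∘ₗ wordComponent B ∘ₗ sndLinear ∘ₗ (toExt B hB).toLinearMap,
    fun l τ ↦ ?_⟩
  rw [← B_apply]
  simp [sndLinear, toExt_letter, toExt_term, inl_mul_inr]

theorem RespectsRelations.linear_relation {i : ℕ} {α β : (Terminal K →₀ K) →ₗ[K] V}
    (h : RespectsRelations i α β) {a : Fin 2 × ℕ →₀ K} {τ : Terminal K →₀ K}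
    (ha : linearForm a * term τ = 0) : a (0, i) • α τ + a (1, i) • β τ = 0 := by
  by_cases hi : i ∈ a.support.image Prod.snd
  · obtain ⟨φ, hφ⟩ := h.exists_functional
    have := congr(φ $ha)
    rw [linearForm_eq_sum] at this
    simpa only [Finset.sum_mul, add_mul, smul_mul_assoc, map_sum, map_add, map_smul, map_zero, hφ,
      Matrix.cons_val_zero, Matrix.cons_val_one, smul_ite, smul_zero,
      Finset.sum_add_distrib, Finset.sum_ite_eq', hi, if_true] using this
  · have ha0 (k : Fin 2) : a (k, i) = 0 := by
      by_contra hk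
      exact hi (Finset.mem_image.2 ⟨(k, i), Finsupp.mem_support_iff.2 hk, rfl⟩)
    simp [ha0]

theorem RespectsRelations.eq_of_letter_mul_eq {i : ℕ} {α β : (Terminal K →₀ K) →ₗ[K] V}
    (h : RespectsRelations i α β) {σ τ : Terminal K →₀ K}
    (h_eq : letter (0, i) * term σ = letter (1, i) * term τ) : α σ = β τ := by
  obtain ⟨φ, hφ⟩ := h.exists_functional
  simpa [hφ] using congr(φ $h_eq)

theorem respectsRelations_aInf (i : ℕ) :
    RespectsRelations i (Finsupp.lapply (aInf : Terminal K)) (0 : _ →ₗ[K] K) := by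
  constructor <;> simp

theorem respectsRelations_aPt (i : ℕ) (μ : K) :
    RespectsRelations i (-μ • Finsupp.lapply (aPt μ)) (Finsupp.lapply (R := K) (aPt μ)) where
  a0_b1_b2 j _ := by simp
  a0_b2_a1_b1 j _ := by simp
  a1_b2 j _ := by simp
  a1_aInf := by simp
  a0_a1_aPt ν := by
    by_cases h : μ = ν <;> simp [h]

theorem respectsRelations_b (i j : ℕ) :
    RespectsRelations i (Finsupp.lapply (b1 j) + Finsupp.lapply (b2 j) : _ →ₗ[K] K)
      (Finsupp.lapply (b1 j)) := by
  classical constructor <;> simp +contextual [Finsupp.single_apply]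

theorem respectsRelations_b1 {i j : ℕ} (hij : j < i) :
    RespectsRelations i (Finsupp.lapply (b1 j)) (0 : _ →ₗ[K] K) where
  a0_b1_b2 k hk := by simp [show k ≠ j by lia]
  a0_b2_a1_b1 k _ := by simp
  a1_b2 k _ := by simp
  a1_aInf := by simp
  a0_a1_aPt μ := by simp

theorem respectsRelations_b2 {i j : ℕ} (hij : j < i) :
    RespectsRelations i (Finsupp.lapply (b2 j)) (0 : _ →ₗ[K] K) where
  a0_b1_b2 k hk := by simp [show k ≠ j by lia]
  a0_b2_a1_b1 k hk := by simp [show k ≠ j by lia]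
  a1_b2 k _ := by simp
  a1_aInf := by simp
  a0_a1_aPt μ := by simp

theorem exists_respectsRelations {τ : Terminal K →₀ K} (hτ : τ ≠ 0) :
    ∃ α β : (Terminal K →₀ K) →ₗ[K] K,
      (∀ i, RespectsRelations i α β) ∧ (α τ ≠ 0 ∨ β τ ≠ 0) := by
  obtain ⟨⟨g, hg⟩, ht⟩ := Finsupp.ne_iff.1 hτ
  cases hg with
  | aInf => exact ⟨_, _, respectsRelations_aInf, .inl ht⟩
  | aPt μ => exact ⟨_, _, (respectsRelations_aPt · μ), .inr ht⟩
  | b1 j => exact ⟨_, _, (respectsRelations_b · j), .inr ht⟩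
  | b2 j =>
    refine ⟨_, _, (respectsRelations_b · j), ?_⟩
    by_contra! h
    exact ht (by simpa [show τ (b1 j) = 0 from h.2] using h.1)

theorem eq_zero_of_det_ne_zero {a b : Fin 2 × ℕ →₀ K} {i j : ℕ}
    (h_det : a (0, i) * b (1, j) - a (1, i) * b (0, j) ≠ 0) {τ : Terminal K →₀ K}
    (ha : linearForm a * term τ = 0) (hb : linearForm b * term τ = 0) : τ = 0 := by
  by_contra hτ
  obtain ⟨α, β, h, h_ne⟩ := exists_respectsRelations hτ
  have ha := (h i).linear_relation ha
  have hb := (h j).linear_relation hb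
  simp only [smul_eq_mul] at ha hb
  have hα : (a (0, i) * b (1, j) - a (1, i) * b (0, j)) * α τ = 0 := by
    linear_combination b (1, j) * ha - a (1, i) * hb
  have hβ : (a (0, i) * b (1, j) - a (1, i) * b (0, j)) * β τ = 0 := by
    linear_combination a (0, i) * hb - b (0, j) * ha
  exact h_ne.elim (mul_ne_zero h_det · hα) (mul_ne_zero h_det · hβ)

theorem eq_zero_of_augmentation_ne_zero {x r : CedoAlgebra K} (hx : augmentation (poly x) ≠ 0)
    (h : x * r = 0) : r = 0 := by
  obtain ⟨τ, rfl⟩ := exists_eq_term_of_mul_eq_zero (by rintro h; simp [h] at hx) h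
  rw [(smul_eq_zero.1 (mul_term_eq_zero_iff.1 h).1).resolve_left hx, map_zero]

theorem exists_linearForm_mul_ne_zero {X : Set (CedoAlgebra K)} (hX : rightAnn X = {0})
    (h_aug : ∀ x ∈ X, augmentation (poly x) = 0) {τ : Terminal K →₀ K} (hτ : τ ≠ 0) :
    ∃ x ∈ X, ∃ u, linearForm (lastLetters (poly x) u) * term τ ≠ 0 := by
  by_contra! h
  refine hτ (term_injective ?_)
  rw [map_zero]
  refine rightAnn_eq_singleton_zero_iff.1 hX _ fun x hx ↦ mul_term_eq_zero_iff.2 ⟨?_, h x hx⟩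
  rw [h_aug x hx, zero_smul]

theorem isRightZip (K : Type*) [Field K] : IsRightZip (CedoAlgebra K) := by
  intro X hX
  by_cases! h_aug : ∃ x ∈ X, augmentation (poly x) ≠ 0
  · obtain ⟨x, hx, h⟩ := h_aug
    exact ⟨{x}, by simpa using hx, Set.finite_singleton x,
      rightAnn_eq_singleton_zero_iff.2 fun r hr ↦ eq_zero_of_augmentation_ne_zero h (hr x rfl)⟩
  obtain ⟨x, hx, u, hxu⟩ :=
    exists_linearForm_mul_ne_zero hX h_aug (τ := Finsupp.single aInf 1) (by simp)
  obtain ⟨i, hi⟩ : ∃ i, lastLetters (poly x) u (0, i) ≠ 0 := by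
    by_contra! h
    exact hxu (linearForm_mul_aInf h)
  set μ := lastLetters (poly x) u (1, i) / lastLetters (poly x) u (0, i) with hμ
  obtain ⟨y, hy, v, hyv⟩ :=
    exists_linearForm_mul_ne_zero hX h_aug (τ := Finsupp.single (aPt μ) 1) (by simp)
  obtain ⟨j, hj⟩ : ∃ j, lastLetters (poly y) v (1, j) ≠ μ * lastLetters (poly y) v (0, j) := by
    by_contra! h
    exact hyv (linearForm_mul_aPt h)
  have h_det : lastLetters (poly x) u (0, i) * lastLetters (poly y) v (1, j) -
      lastLetters (poly x) u (1, i) * lastLetters (poly y) v (0, j) ≠ 0 := by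
    contrapose! hj
    rw [hμ]
    field_simp
    linear_combination hj
  refine ⟨{x, y}, by grind, Set.toFinite _, rightAnn_eq_singleton_zero_iff.2 fun r hr ↦ ?_⟩
  obtain ⟨τ, rfl⟩ := exists_eq_term_of_mul_eq_zero (by rintro h; simp [h] at hi) (hr x (by simp))
  rw [eq_zero_of_det_ne_zero h_det ((mul_term_eq_zero_iff.1 (hr x (by simp))).2 u)
    ((mul_term_eq_zero_iff.1 (hr y (by simp))).2 v), map_zero]

theorem exists_eq_term_of_letter_mul_eq {x : CedoAlgebra K} {i : ℕ} {τ : Terminal K →₀ K}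
    (h : letter (0, i) * x = letter (1, i) * term τ) : ∃ σ, x = term σ := by
  classical
  have h_model := congr(model $h)
  rw [map_mul, map_mul, model_letter, model_letter, model_term] at h_model
  have h_poly : poly x = 0 := by simpa [X] using congr(fst $h_model)
  refine exists_eq_term h_poly (Finsupp.ext fun w ↦ ?_)
  have := congr(wordComponent letterMul (snd $h_model) (of (0, i) * w))
  simpa [wordComponent_X_smul_of_mul] using this

theorem coeff_witness_mul (i n : ℕ) (f : PowerSeries (CedoAlgebra K)) :
    PowerSeries.coeff n ((PowerSeries.C (gen K (.a0 i)) -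
      PowerSeries.C (gen K (.a1 i)) * PowerSeries.X) * f) =
      letter (0, i) * PowerSeries.coeff (n + 1) (PowerSeries.X * f) -
        letter (1, i) * PowerSeries.coeff n (PowerSeries.X * f) := by
  rw [sub_mul, mul_assoc, map_sub, PowerSeries.coeff_C_mul, PowerSeries.coeff_C_mul,
    PowerSeries.coeff_succ_X_mul]
  rfl

theorem eq_zero_of_letter_mul_succ_eq {τ : ℕ → Terminal K →₀ K} (h_zero : τ 0 = 0)
    (h_succ : ∀ i n, letter (0, i) * term (τ (n + 1)) = letter (1, i) * term (τ n)) (n : ℕ) :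
    τ n = 0 := by
  have of_snd_eq_zero (n : ℕ) {i : ℕ} {α : (Terminal K →₀ K) →ₗ[K] K}
      (h : RespectsRelations i α 0) : α (τ n) = 0 := by
    cases n with
    | zero => rw [h_zero, map_zero]
    | succ n => exact h.eq_of_letter_mul_eq (h_succ i n)
  ext ⟨g, hg⟩
  cases hg with
  | aInf => exact of_snd_eq_zero n (respectsRelations_aInf 0)
  | b1 j => exact of_snd_eq_zero n (respectsRelations_b1 j.lt_succ_self)
  | b2 j => exact of_snd_eq_zero n (respectsRelations_b2 j.lt_succ_self)
  | aPt μ =>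
    have h_aPt (n : ℕ) : -μ * τ (n + 1) (aPt μ) = τ n (aPt μ) :=
      (respectsRelations_aPt 0 μ).eq_of_letter_mul_eq (h_succ 0 n)
    by_cases hμ : μ = 0
    · simpa [hμ] using (h_aPt n).symm
    · induction n with
      | zero => simp [h_zero]
      | succ n ih => exact (mul_eq_zero.1 ((h_aPt n).trans ih)).resolve_left (neg_ne_zero.2 hμ)

theorem rightAnn_cedoWitness (K : Type*) [Field K] : rightAnn (cedoWitness K) = {0} := by
  refine rightAnn_eq_singleton_zero_iff.2 fun f hf ↦ ?_
  set c : ℕ → CedoAlgebra K := fun n ↦ PowerSeries.coeff n (PowerSeries.X * f) with hc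
  have h_succ (i n : ℕ) : letter (0, i) * c (n + 1) = letter (1, i) * c n := by
    rw [← sub_eq_zero, hc, ← coeff_witness_mul, hf _ ⟨i, rfl⟩, map_zero]
  have h_zero : c 0 = 0 := PowerSeries.coeff_zero_X_mul f
  have h_term (n : ℕ) : ∃ τ, c n = term τ := by
    induction n with
    | zero => exact ⟨0, by rw [h_zero, map_zero]⟩
    | succ n ih =>
      obtain ⟨τ, hτ⟩ := ih
      exact exists_eq_term_of_letter_mul_eq (hτ ▸ h_succ 0 n)
  choose τ hτ using h_term
  have hτ0 : τ 0 = 0 := term_injective (by rw [← hτ, h_zero, map_zero])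
  ext n
  rw [← PowerSeries.coeff_succ_X_mul, map_zero]
  refine (hτ (n + 1)).trans ?_
  rw [eq_zero_of_letter_mul_succ_eq hτ0 (by simpa only [hτ] using h_succ), map_zero]

theorem witness_mul_eq_zero {i n : ℕ} (h : i ≤ n) :
    (PowerSeries.C (gen K (.a0 i)) - PowerSeries.C (gen K (.a1 i)) * PowerSeries.X) *
      (PowerSeries.C (gen K (.b1 n) - gen K (.b2 n)) +
        PowerSeries.C (gen K (.b2 n)) * PowerSeries.X) = 0 := by
  have hR := respectsRelations_letterMul (K := K) i
  have h₁ := hR.a0_b1_b2 n h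
  have h₂ := hR.a0_b2_a1_b1 n h
  have h₃ := hR.a1_b2 n h
  simp only [letterMul_apply, term_single, one_smul, letter] at h₁ h₂ h₃
  have C_mul_X_mul_C (r s : CedoAlgebra K) :
      PowerSeries.C r * PowerSeries.X * PowerSeries.C s =
        PowerSeries.C (r * s) * PowerSeries.X := by
    rw [mul_assoc, PowerSeries.X_mul, ← mul_assoc, map_mul]
  rw [sub_mul, mul_add, mul_add, C_mul_X_mul_C, ← mul_assoc, ← mul_assoc, C_mul_X_mul_C,
    ← map_mul, ← map_mul, mul_sub, mul_sub, h₁, h₂, h₃]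
  simp

theorem rightAnn_ne_singleton_zero_of_finite {F : Set (PowerSeries (CedoAlgebra K))}
    (hF : F ⊆ cedoWitness K) (hfin : F.Finite) : rightAnn F ≠ {0} := by
  rw [cedoWitness, ← Set.image_univ] at hF
  obtain ⟨I, -, hI, rfl⟩ := hfin.exists_subset_finite_image_eq hF
  obtain ⟨n, hn⟩ := hI.bddAbove
  intro h
  have h_zero := rightAnn_eq_singleton_zero_iff.1 h
    (PowerSeries.C (gen K (.b1 n) - gen K (.b2 n)) + PowerSeries.C (gen K (.b2 n)) * PowerSeries.X)
    (by rintro _ ⟨i, hi, rfl⟩; exact witness_mul_eq_zero (hn hi))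
  have h_b2 : term (Finsupp.single (b2 n) (1 : K)) = term 0 := by
    simpa [PowerSeries.coeff_C] using congr(PowerSeries.coeff 1 $h_zero)
  simpa using term_injective h_b2

end CedoAlgebra

theorem mainTheorem5 (K : Type*) [Field K] :
    IsRightZip (CedoAlgebra K) ∧
    rightAnn (cedoWitness K) = {0} ∧
    (∀ F : Set (PowerSeries (CedoAlgebra K)), F ⊆ cedoWitness K → F.Finite →
      rightAnn F ≠ {0}) ∧
    ¬ IsRightZip (PowerSeries (CedoAlgebra K)) := by
  refine ⟨CedoAlgebra.isRightZip K, CedoAlgebra.rightAnn_cedoWitness K,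
    fun F hF hfin ↦ CedoAlgebra.rightAnn_ne_singleton_zero_of_finite hF hfin, fun h ↦ ?_⟩
  obtain ⟨F, hF, hfin, h_zero⟩ := h _ (CedoAlgebra.rightAnn_cedoWitness K)
  exact CedoAlgebra.rightAnn_ne_singleton_zero_of_finite hF hfin h_zero
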